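/- Let $N\ge 1$ and $m\ge 1$ be integers and let $B_r(x)$ be the open ball in $\mathbb R^N$. For $0<s<1$ and $u:\mathbb R^N\to\mathbb R$ put $$(-\Delta)^s u(x)=c_{N,s}\lim_{\varepsilon\to0^+}\int_{\mathbb R^N\setminus B_\varepsilon(x)}\frac{u(x)-u(y)}{|x-y|^{N+2s}}\,dy,\qquad c_{N,s}=2^{2s}\pi^{-N/2}\,s\,\frac{\Gamma(\frac{N+2s}{2})}{\Gamma(1-s)},$$ whenever the integrals and the limit exist. Let $$\kappa_1(s)=2^{-2s}\pi^{-N/2}\,\frac{\Gamma(\frac{N-2s}{2})}{\Gamma(1+s)},\qquad \kappa_2(s)=2^{-2s}\,\frac{\Gamma(\frac{N-2s}{2})}{\Gamma(\frac N2)\,\Gamma(1+s)},$$ let $\mathcal K_0u=u$ and, for integers $n\ge1$, $$\mathcal K_nu(x)=\int_{\mathbb R^N}\big(u(x)1_{B_1(x)}(y)-u(y)\big)\,|x-y|^{-N}\,(-2\ln|x-y|)^{n-1}\,dy .$$ The $m$-order logarithmic Laplacian is $\mathcal L_mu=\sum_{j=0}^m\alpha_j\,\mathcal K_ju$, where $$\alpha_0=(-1)^m\kappa_2^{(m)}(0),\qquad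 \alpha_j=m(-1)^{m+j}\binom{m-1}{j-1}\kappa_1^{(m-j)}(0)\quad(1\le j\le m).$$ **Theorem.** Let $\alpha>0$ and let $\zeta:\mathbb R^N\to\mathbb R$ be an $\alpha$-Hölder continuous function with compact support (i.e. $\zeta\in C^{0,\alpha}_c(\mathbb R^N)$). (i) The integrals defining $\mathcal K_j\zeta(x)$, $1\le j\le m$, converge absolutely for every $x\in\mathbb R^N$. There is $\delta\in(0,\frac14]$ such that for every $x\in\mathbb R^N$: $(-\Delta)^s\zeta(x)$ is well defined for all $s\in(0,\delta)$; the function $s\mapsto(-\Delta)^s\zeta(x)$, extended by the value $\zeta(x)$ at $s=0$, is of class $C^m$ on $[0,\delta)$; and $$\frac{d^m}{ds^m}\Big|_{s=0^+}(-\Delta)^s\zeta(x)=\mathcal L_m\zeta(x),$$ both as the $m$-th right derivative at $0$ of the extended function and as the limit of the $m$-th derivative as $s\to0^+$. (ii) For every $p\in(1,\infty]$, $\mathcal L_m\zeta\in L^p(\mathbb R^N)$, the functions $$\frac{m!}{s^m}\Big((-\Delta)^s\zeta-\zeta-\sum_{j=1}^{m-1}\frac{s^j}{j!}\,\mathcal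 L_j\zeta\Big)$$ belong to $L^p(\mathbb R^N)$ for all sufficiently small $s>0$, and they converge to $\mathcal L_m\zeta$ in $L^p(\mathbb R^N)$ as $s\to0^+$. -/

import Mathlib

open Set Filter Topology MeasureTheory
open scoped NNReal ENNReal

noncomputable section

namespace LogLaplace

/-- The Euclidean space `ℝ^N`. -/
abbrev Space (N : ℕ) : Type := EuclideanSpace ℝ (Fin N)

/-- The normalizing constant `c_{N,s} = 2^{2s} π^{-N/2} s Γ((N+2s)/2) / Γ(1-s)`. -/
def fracConst (N : ℕ) (s : ℝ) : ℝ :=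
  (2 : ℝ) ^ (2 * s) * Real.pi ^ (-(N : ℝ) / 2) * s *
    (Real.Gamma (((N : ℝ) + 2 * s) / 2) / Real.Gamma (1 - s))

/-- The integrand `y ↦ (u(x) - u(y)) / |x - y|^{N+2s}` of the fractional Laplacian. -/
def fracIntegrand {N : ℕ} (s : ℝ) (u : Space N → ℝ) (x y : Space N) : ℝ :=
  (u x - u y) / ‖x - y‖ ^ ((N : ℝ) + 2 * s)

/-- The truncated integral `c_{N,s} ∫_{ℝ^N \ B_ε(x)} (u(x) - u(y)) / |x - y|^{N+2s} dy`. -/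
def fracTruncated {N : ℕ} (s : ℝ) (u : Space N → ℝ) (x : Space N) (ε : ℝ) : ℝ :=
  fracConst N s * ∫ y in (Metric.ball x ε)ᶜ, fracIntegrand s u x y

/-- The fractional Laplacian `(-Δ)^s u(x)`, `0 < s < 1`, as the limit of the truncated integrals
as `ε → 0⁺`; it is meaningful where `FracLaplaceExists s u x` holds. -/
def fracLaplace {N : ℕ} (s : ℝ) (u : Space N → ℝ) (x : Space N) : ℝ :=
  limUnder (𝓝[>] (0 : ℝ)) (fracTruncated s u x)

/-- The integrals defining `(-Δ)^s u(x)` converge absolutely away from `x`, and they have a limit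
as `ε → 0⁺`. -/
def FracLaplaceExists {N : ℕ} (s : ℝ) (u : Space N → ℝ) (x : Space N) : Prop :=
  (∀ ε : ℝ, 0 < ε → IntegrableOn (fracIntegrand s u x) (Metric.ball x ε)ᶜ) ∧
    ∃ v : ℝ, Tendsto (fracTruncated s u x) (𝓝[>] (0 : ℝ)) (𝓝 v)

/-- `κ₁(s) = 2^{-2s} π^{-N/2} Γ((N-2s)/2) / Γ(1+s)`. -/
def kappa1 (N : ℕ) (s : ℝ) : ℝ :=
  (2 : ℝ) ^ (-(2 * s)) * Real.pi ^ (-(N : ℝ) / 2) *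
    (Real.Gamma (((N : ℝ) - 2 * s) / 2) / Real.Gamma (1 + s))

/-- `κ₂(s) = 2^{-2s} Γ((N-2s)/2) / (Γ(N/2) Γ(1+s))`. -/
def kappa2 (N : ℕ) (s : ℝ) : ℝ :=
  (2 : ℝ) ^ (-(2 * s)) *
    (Real.Gamma (((N : ℝ) - 2 * s) / 2) / (Real.Gamma ((N : ℝ) / 2) * Real.Gamma (1 + s)))

/-- The radial kernel `q_n(t) = t^{-N} (-2 ln t)^{n-1}`, for `n ≥ 1` and `t > 0`. -/
def kernelQ (N n : ℕ) (t : ℝ) : ℝ :=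
  (t ^ N)⁻¹ * (-2 * Real.log t) ^ (n - 1)

/-- The integrand `y ↦ (u(x) 1_{B_1(x)}(y) - u(y)) q_n(|x - y|)` of `K_n u(x)`, for `n ≥ 1`. -/
def zeroOrderIntegrand {N : ℕ} (n : ℕ) (u : Space N → ℝ) (x y : Space N) : ℝ :=
  ((Metric.ball x 1).indicator (fun _ => u x) y - u y) * kernelQ N n ‖x - y‖

/-- The zero order kernel operators: `K_0 u = u` and, for `n ≥ 1`,
`K_n u(x) = ∫ (u(x) 1_{B_1(x)}(y) - u(y)) q_n(|x - y|) dy`. -/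
def zeroOrderOp {N : ℕ} (n : ℕ) (u : Space N → ℝ) (x : Space N) : ℝ :=
  if n = 0 then u x else ∫ y, zeroOrderIntegrand n u x y

/-- The coefficients (for `m ≥ 1`) `α_0 = (-1)^m κ₂^{(m)}(0)` and
`α_j = m (-1)^{m+j} (m-1 choose j-1) κ₁^{(m-j)}(0)` for `1 ≤ j ≤ m`. -/
def logCoeff (N m j : ℕ) : ℝ :=
  if j = 0 then (-1) ^ m * iteratedDeriv m (kappa2 N) 0
  else (m : ℝ) * (-1) ^ (m + j) * ((m - 1).choose (j - 1) : ℝ) *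
    iteratedDeriv (m - j) (kappa1 N) 0

/-- The `m`-order logarithmic Laplacian `L_m u = ∑_{j=0}^m α_j K_j u`, for `m ≥ 1`. -/
def logLaplace {N : ℕ} (m : ℕ) (u : Space N → ℝ) (x : Space N) : ℝ :=
  ∑ j ∈ Finset.range (m + 1), logCoeff N m j * zeroOrderOp j u x

/-- The normalized Taylor remainder
`(m! / s^m) ((-Δ)^s u - u - ∑_{j=1}^{m-1} (s^j / j!) L_j u)`. -/
def taylorRemainder {N : ℕ} (m : ℕ) (u : Space N → ℝ) (s : ℝ) (x : Space N) : ℝ :=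
  (m.factorial : ℝ) / s ^ m *
    (fracLaplace s u x - u x -
      ∑ j ∈ Finset.Ico 1 m, s ^ j / (j.factorial : ℝ) * logLaplace j u x)

end LogLaplace

end

/-! Cut the kernel at distance one by writing u(x) - u(y) = (u(x) 1_{B_1(x)}(y) - u(y)) + u(x)
1_{|x-y| ≥ 1}. The second piece integrates explicitly: c_{N,s} times the tail integral of
|z|^{-N-2s} equals κ₂(-s). Since c_{N,s} = s κ₁(-s), this gives (-Δ)^s u(x) = κ₂(-s) u(x) + s κ₁(-s)
I(s), where I(s) integrates the first piece against |x-y|^{-N-2s}.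

The right side, `fracExtension`, makes sense on both sides of s = 0. For 2s < a, with a the Hölder
exponent, Hölder continuity tames the singularity at y = x and compact support tames infinity, so I
may be differentiated under the integral any number of times (`hasDerivAt_powLogIntegral`). Each
derivative brings down a factor -2 ln|x-y|, and at s = 0 the j-th derivative of I is K_{j+1} u. The
Leibniz rule at 0 then produces the coefficients α_j (`iteratedDeriv_fracExtension_zero`), which
proves (i).

For (ii), every s-derivative of `fracExtension` is O((1+|x|)^{-(N-β)}) uniformly for small s ≥ 0,
with β > 0 arbitrarily small. Taylor's formula bounds the error of the normalized remainder by s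
times this function, which lies in L^p for p > 1 once β is small. -/

noncomputable section

namespace LogLaplace

/-! ### Kernels with logarithms and their pointwise domination -/

/-- The kernel `t ^ (-N - 2s) (-2 ln t) ^ j`, the `j`-th derivative in `s` of `t ^ (-N - 2s)`. -/
def powLogKernel (N j : ℕ) (s t : ℝ) : ℝ :=
  t ^ (-(N : ℝ) - 2 * s) * (-2 * Real.log t) ^ j

/-- The integrand `y ↦ (u(x) 1_{B_1(x)}(y) - u(y)) |x - y| ^ (-N - 2s) (-2 ln |x - y|) ^ j`. -/
def powLogIntegrand {N : ℕ} (j : ℕ) (u : Space N → ℝ) (s : ℝ) (x y : Space N) : ℝ :=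
  ((Metric.ball x 1).indicator (fun _ => u x) y - u y) * powLogKernel N j s ‖x - y‖

/-- The integral of `powLogIntegrand`. -/
def powLogIntegral {N : ℕ} (j : ℕ) (u : Space N → ℝ) (s : ℝ) (x : Space N) : ℝ :=
  ∫ y, powLogIntegrand j u s x y

/-- Apply y^j / j! ≤ e^y with y = β |ln t|; the exponential is the larger of t^β and t^{-β}. -/
theorem exists_abs_log_pow_le (j : ℕ) {β : ℝ} (hβ : 0 < β) :
    ∃ C : ℝ, 0 ≤ C ∧ ∀ t : ℝ, 0 < t → |-2 * Real.log t| ^ j ≤ C * (t ^ β + t ^ (-β)) := by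
  refine ⟨(2 / β) ^ j * j.factorial, by positivity, fun t ht => ?_⟩
  have h1 := Real.pow_div_factorial_le_exp (β * |Real.log t|) (by positivity) j
  have h2 : Real.exp (β * |Real.log t|) ≤ t ^ β + t ^ (-β) := by
    rw [Real.rpow_def_of_pos ht, Real.rpow_def_of_pos ht]
    rcases abs_cases (Real.log t) with ⟨h, _⟩ | ⟨h, _⟩ <;> rw [h]
    · rw [mul_comm]
      linarith [Real.exp_pos (Real.log t * -β)]
    · rw [show β * -Real.log t = Real.log t * -β by ring]
      linarith [Real.exp_pos (Real.log t * β)]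
  have h3 : |-2 * Real.log t| ^ j = (2 / β) ^ j * (β * |Real.log t|) ^ j := by
    rw [← mul_pow, abs_mul]
    congr 1
    field_simp
    norm_num
  rw [h3, mul_assoc]
  gcongr
  rw [div_le_iff₀ (by positivity)] at h1
  nlinarith [show (0 : ℝ) < j.factorial by positivity]

/-- The radial profile `t ^ (γ - N)` cut off to `t < 1`. -/
def localProfile (N : ℕ) (γ t : ℝ) : ℝ :=
  (Iio (1 : ℝ)).indicator (fun t => t ^ (γ - N)) t

theorem localProfile_nonneg (N : ℕ) (γ : ℝ) {t : ℝ} (ht : 0 ≤ t) : 0 ≤ localProfile N γ t := by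
  unfold localProfile
  rw [indicator_apply]
  split_ifs <;> positivity

/-- Pointwise domination of `powLogIntegrand`, uniformly for `s ∈ [σ, δ]`. -/
theorem exists_abs_powLogIntegrand_le {N : ℕ} (j : ℕ) {u : Space N → ℝ} {a H R : ℝ}
    (hH : 0 ≤ H) (hu : ∀ x y, |u x - u y| ≤ H * ‖x - y‖ ^ a)
    (hR : ∀ x, R < ‖x‖ → u x = 0) {β : ℝ} (hβ : 0 < β) (σ δ : ℝ) :
    ∃ C : ℝ, 0 ≤ C ∧ ∀ s ∈ Icc σ δ, ∀ x y : Space N, |powLogIntegrand j u s x y| ≤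
      C * ((Metric.closedBall (0 : Space N) (R + 1)).indicator (fun _ => (1 : ℝ)) x *
          localProfile N (a - 2 * δ - β) ‖x - y‖ +
        |u y| * max 1 ‖x - y‖ ^ (-(N : ℝ) - 2 * σ + β)) := by
  obtain ⟨C, hC0, hC⟩ := exists_abs_log_pow_le j hβ
  -- The near region costs 2CH and the far region 2C; the factor 2 absorbs the smaller of t^β and
  -- t^{-β}.
  refine ⟨2 * C * (H + 1), by positivity, fun s hs x y => ?_⟩
  have hP := localProfile_nonneg N (a - 2 * δ - β) (norm_nonneg (x - y))
  have hI : 0 ≤ (Metric.closedBall (0 : Space N) (R + 1)).indicator (fun _ => (1 : ℝ)) x :=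
    indicator_nonneg (fun _ _ => zero_le_one) x
  have hT : 0 ≤ |u y| * max 1 ‖x - y‖ ^ (-(N : ℝ) - 2 * σ + β) := by positivity
  have hR0 : 0 ≤ 2 * C * (H + 1) *
      ((Metric.closedBall (0 : Space N) (R + 1)).indicator (fun _ => (1 : ℝ)) x *
          localProfile N (a - 2 * δ - β) ‖x - y‖ +
        |u y| * max 1 ‖x - y‖ ^ (-(N : ℝ) - 2 * σ + β)) := by positivity
  unfold powLogIntegrand powLogKernel
  rcases lt_or_ge ‖x - y‖ 1 with h1 | h1
  · have hmem : y ∈ Metric.ball x 1 := by rwa [mem_ball_iff_norm']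
    rw [indicator_of_mem hmem]
    by_cases hx : x ∈ Metric.closedBall (0 : Space N) (R + 1)
    · rcases eq_or_lt_of_le (norm_nonneg (x - y)) with h0 | h0
      · have : x = y := by rw [← sub_eq_zero, ← norm_eq_zero, h0]
        have hz : u x - u y = 0 := by rw [this, sub_self]
        rw [hz, zero_mul, abs_zero]
        exact hR0
      · rw [indicator_of_mem hx, one_mul, localProfile, indicator_of_mem (by exact h1), abs_mul,
          abs_mul, abs_pow, abs_of_pos (Real.rpow_pos_of_pos h0 _)]
        set t := ‖x - y‖
        calc |u x - u y| * (t ^ (-(N : ℝ) - 2 * s) * |-2 * Real.log t| ^ j)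
            ≤ (H * t ^ a) * (t ^ (-(N : ℝ) - 2 * δ) * (C * (2 * t ^ (-β)))) := by
              gcongr ?_ * (?_ * ?_)
              · exact hu x y
              · exact Real.rpow_le_rpow_of_exponent_ge h0 h1.le (by linarith [hs.2])
              · refine (hC t h0).trans ?_
                gcongr
                have := Real.rpow_le_rpow_of_exponent_ge h0 h1.le (by linarith : -β ≤ β)
                linarith
          _ = 2 * C * H * t ^ (a - 2 * δ - β - N) := by
              rw [show a - 2 * δ - β - N = a + ((-(N : ℝ) - 2 * δ) + -β) by ring,
                Real.rpow_add h0, Real.rpow_add h0]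
              ring
          _ ≤ 2 * C * (H + 1) * (t ^ (a - 2 * δ - β - N) +
                |u y| * max 1 t ^ (-(N : ℝ) - 2 * σ + β)) := by
              gcongr
              · linarith
              · linarith
    -- Here |x| > R + 1 and |x - y| < 1, so both points lie outside the support and the difference
    -- vanishes.
    · rw [mem_closedBall_zero_iff, not_le] at hx
      have hx0 : u x = 0 := hR x (by linarith)
      have hy0 : u y = 0 := hR y (by
        have := norm_sub_norm_le x y
        linarith)
      have hz : u x - u y = 0 := by rw [hx0, hy0, sub_self]
      rw [hz, zero_mul, abs_zero]
      exact hR0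
  · have hmem : y ∉ Metric.ball x 1 := by
      rw [mem_ball_iff_norm']
      exact not_lt.2 h1
    have h0 : 0 < ‖x - y‖ := by linarith
    rw [indicator_of_notMem hmem, zero_sub, abs_mul, abs_mul, abs_neg, abs_pow,
      abs_of_pos (Real.rpow_pos_of_pos h0 _), max_eq_right h1]
    rw [max_eq_right h1] at hT
    set t := ‖x - y‖
    calc |u y| * (t ^ (-(N : ℝ) - 2 * s) * |-2 * Real.log t| ^ j)
        ≤ |u y| * (t ^ (-(N : ℝ) - 2 * σ) * (C * (2 * t ^ β))) := by
          gcongr ?_ * (?_ * ?_)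
          · exact Real.rpow_le_rpow_of_exponent_le h1 (by linarith [hs.1])
          · refine (hC t h0).trans ?_
            gcongr
            have := Real.rpow_le_rpow_of_exponent_le h1 (by linarith : -β ≤ β)
            linarith
      _ = 2 * C * 1 * (|u y| * t ^ (-(N : ℝ) - 2 * σ + β)) := by
          rw [Real.rpow_add h0]
          ring
      _ ≤ _ := by
          gcongr
          · linarith
          · exact le_add_of_nonneg_left (by positivity)

/-! ### Integrability, differentiation under the integral, and decay in x -/

/-- In polar coordinates the weight t^{N-1} turns the profile into t^{γ-1} on (0,1), integrable for
γ > 0. -/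
theorem integrable_localProfile_norm {N : ℕ} (hN : 1 ≤ N) {γ : ℝ} (hγ : 0 < γ) :
    Integrable (fun z : Space N => localProfile N γ ‖z‖) := by
  have : Nonempty (Fin N) := ⟨⟨0, hN⟩⟩
  have hpow : IntegrableOn (fun t : ℝ => t ^ (γ - 1)) (Ioo 0 1) :=
    (intervalIntegral.integrableOn_Ioo_rpow_iff one_pos).2 (by linarith)
  rw [integrable_fun_norm_addHaar volume (f := localProfile N γ)]
  have hI : IntegrableOn ((Iio (1 : ℝ)).indicator fun t => t ^ (γ - 1)) (Ioi 0) := by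
    rw [IntegrableOn, integrable_indicator_iff measurableSet_Iio, IntegrableOn,
      Measure.restrict_restrict measurableSet_Iio, Iio_inter_Ioi]
    exact hpow
  refine hI.congr_fun (fun t ht => ?_) measurableSet_Ioi
  have ht : 0 < t := ht
  rw [finrank_euclideanSpace_fin, smul_eq_mul, localProfile]
  simp only [indicator_apply]
  split_ifs
  · rw [← Real.rpow_natCast, ← Real.rpow_add ht, Nat.cast_sub hN]
    congr 1
    push_cast
    ring
  · simp

theorem integrable_localProfile_norm_sub {N : ℕ} (hN : 1 ≤ N) {γ : ℝ} (hγ : 0 < γ)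
    (x : Space N) : Integrable (fun y : Space N => localProfile N γ ‖x - y‖) :=
  (integrable_localProfile_norm hN hγ).comp_sub_left x

theorem continuous_max_norm_sub_rpow {N : ℕ} (e : ℝ) (x : Space N) :
    Continuous fun y : Space N => max 1 ‖x - y‖ ^ e := by
  refine Continuous.rpow_const (by fun_prop) fun y => Or.inl ?_
  have := le_max_left 1 ‖x - y‖
  positivity

theorem integrable_abs_mul_max_norm_sub_rpow {N : ℕ} {u : Space N → ℝ} (hu : Continuous u)
    (huc : HasCompactSupport u) (e : ℝ) (x : Space N) :
    Integrable fun y => |u y| * max 1 ‖x - y‖ ^ e := by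
  refine (hu.abs.mul (continuous_max_norm_sub_rpow e x)).integrable_of_hasCompactSupport ?_
  exact HasCompactSupport.mul_right (f := fun y => |u y|) huc.abs

/-- Joint measurability in (x, y) is what makes the integral measurable in x, as the L^p statements
require. -/
theorem measurable_powLogIntegrand {N : ℕ} (j : ℕ) {u : Space N → ℝ} (hu : Continuous u) (s : ℝ) :
    Measurable (Function.uncurry (powLogIntegrand j u s)) := by
  have hu' := hu.measurable
  have h1 : (Function.uncurry (powLogIntegrand j u s)) = fun p : Space N × Space N =>
      ({p : Space N × Space N | ‖p.1 - p.2‖ < 1}.indicator (fun p => u p.1) p - u p.2) *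
        (‖p.1 - p.2‖ ^ (-(N : ℝ) - 2 * s) * (-2 * Real.log ‖p.1 - p.2‖) ^ j) := by
    ext ⟨x, y⟩
    by_cases h : ‖x - y‖ < 1 <;>
      simp [powLogIntegrand, powLogKernel, indicator, h, dist_comm y x, dist_eq_norm x y]
  rw [h1]
  have hS : MeasurableSet {p : Space N × Space N | ‖p.1 - p.2‖ < 1} :=
    measurableSet_lt (by fun_prop) measurable_const
  have h2 : Measurable fun p : Space N × Space N => u p.1 := hu'.comp measurable_fst
  have h3 := h2.indicator hS
  fun_prop

theorem stronglyMeasurable_powLogIntegral {N : ℕ} (j : ℕ) {u : Space N → ℝ} (hu : Continuous u)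
    (s : ℝ) : StronglyMeasurable (powLogIntegral j u s) :=
  (measurable_powLogIntegrand j hu s).stronglyMeasurable.integral_prod_right

theorem hasDerivAt_powLogIntegrand {N : ℕ} (j : ℕ) (u : Space N → ℝ)
    (x y : Space N) (s : ℝ) :
    HasDerivAt (fun s => powLogIntegrand j u s x y) (powLogIntegrand (j + 1) u s x y) s := by
  unfold powLogIntegrand powLogKernel
  rcases eq_or_lt_of_le (norm_nonneg (x - y)) with h0 | h0
  -- On the diagonal the prefactor u(x) - u(x) vanishes, whatever value the kernel takes at 0.
  · have hxy : x = y := by rw [← sub_eq_zero, ← norm_eq_zero, h0]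
    subst hxy
    simp [hasDerivAt_const]
  · have h1 : HasDerivAt (fun s : ℝ => -(N : ℝ) - 2 * s) (-2) s := by
      simpa using ((hasDerivAt_id s).const_mul 2).const_sub (-(N : ℝ))
    have h2 := ((h1.const_rpow h0).mul_const ((-2 * Real.log ‖x - y‖) ^ j)).const_mul
      ((Metric.ball x 1).indicator (fun _ => u x) y - u y)
    refine h2.congr_deriv ?_
    ring

section Hoelder

variable {N : ℕ} {u : Space N → ℝ} {a H R δ : ℝ}

theorem integrable_powLogIntegrand (hN : 1 ≤ N) (hH : 0 ≤ H)
    (hu : ∀ x y, |u x - u y| ≤ H * ‖x - y‖ ^ a) (hR : ∀ x, R < ‖x‖ → u x = 0)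
    (huc : Continuous u) (hus : HasCompactSupport u) (j : ℕ) {s : ℝ} (hs : 2 * s < a)
    (x : Space N) : Integrable (powLogIntegrand j u s x) := by
  obtain ⟨C, _, hC⟩ := exists_abs_powLogIntegrand_le j hH hu hR
    (show 0 < (a - 2 * s) / 2 by linarith) s s
  refine Integrable.mono' ((((integrable_localProfile_norm_sub hN
    (show 0 < a - 2 * s - (a - 2 * s) / 2 by linarith) x).const_mul _).add
    (integrable_abs_mul_max_norm_sub_rpow huc hus _ x)).const_mul C) ?_
    (ae_of_all _ fun y => hC s ⟨le_rfl, le_rfl⟩ x y)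
  exact ((measurable_powLogIntegrand j huc s).comp measurable_prodMk_left).aestronglyMeasurable

theorem hasDerivAt_powLogIntegral (hN : 1 ≤ N) (hH : 0 ≤ H)
    (hu : ∀ x y, |u x - u y| ≤ H * ‖x - y‖ ^ a) (hR : ∀ x, R < ‖x‖ → u x = 0)
    (huc : Continuous u) (hus : HasCompactSupport u) (j : ℕ) {s : ℝ} (hs : 2 * s < a)
    (x : Space N) :
    HasDerivAt (fun s => powLogIntegral j u s x) (powLogIntegral (j + 1) u s x) s := by
  -- The window [s - 1, δ] is a neighbourhood of s, and with β = (a - 2δ)/2 the local exponent a -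
  -- 2δ - β stays positive. Negative s are allowed, so derivatives at 0 are two-sided.
  obtain ⟨δ, hsδ, hδ⟩ := exists_between (show s < a / 2 by linarith)
  obtain ⟨C, _, hC⟩ := exists_abs_powLogIntegrand_le (j + 1) hH hu hR
    (show 0 < (a - 2 * δ) / 2 by linarith) (s - 1) δ
  have hmeas : ∀ k s, AEStronglyMeasurable (powLogIntegrand k u s x) volume := fun k s =>
    ((measurable_powLogIntegrand k huc s).comp measurable_prodMk_left).aestronglyMeasurable
  exact (hasDerivAt_integral_of_dominated_loc_of_deriv_le
    (Icc_mem_nhds (by linarith) hsδ) (Eventually.of_forall fun s => hmeas j s)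
    (integrable_powLogIntegrand hN hH hu hR huc hus j hs x) (hmeas _ s)
    (ae_of_all _ fun y s hs => hC s hs x y)
    ((((integrable_localProfile_norm_sub hN
      (show 0 < a - 2 * δ - (a - 2 * δ) / 2 by linarith) x).const_mul _).add
      (integrable_abs_mul_max_norm_sub_rpow huc hus _ x)).const_mul C)
    (ae_of_all _ fun y s _ => hasDerivAt_powLogIntegrand j u x y s)).2

/-- Decay of `powLogIntegral` at infinity, uniformly for `s ∈ [0, δ]`. -/
theorem exists_abs_powLogIntegral_le (hN : 1 ≤ N) (hH : 0 ≤ H)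
    (hu : ∀ x y, |u x - u y| ≤ H * ‖x - y‖ ^ a) (hR0 : 0 ≤ R) (hR : ∀ x, R < ‖x‖ → u x = 0)
    (huc : Continuous u) (hus : HasCompactSupport u) (j : ℕ) {β : ℝ} (hβ : 0 < β) (hβN : β ≤ N)
    (hδ : 2 * δ + β < a) :
    ∃ C : ℝ, 0 ≤ C ∧ ∀ s ∈ Icc 0 δ, ∀ x : Space N,
      |powLogIntegral j u s x| ≤ C * (1 + ‖x‖) ^ (-((N : ℝ) - β)) := by
  obtain ⟨C, hC0, hC⟩ := exists_abs_powLogIntegrand_le j hH hu hR hβ 0 δ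
  have hγ : 0 < a - 2 * δ - β := by linarith
  set P := ∫ z : Space N, localProfile N (a - 2 * δ - β) ‖z‖ with hP
  have hP0 : 0 ≤ P := integral_nonneg fun z => localProfile_nonneg N _ (norm_nonneg z)
  set e := (N : ℝ) - β with he
  have he0 : 0 ≤ e := by rw [he]; linarith
  set U := ∫ y, |u y|
  have hU0 : 0 ≤ U := integral_nonneg fun y => abs_nonneg _
  have hUi : Integrable fun y => |u y| :=
    huc.abs.integrable_of_hasCompactSupport hus.abs
  -- For |y| ≤ R one has 1 + |x| ≤ 2(1 + R) max(1, |x-y|), and for |x| ≤ R + 1 one has 1 + |x| ≤ 2(1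
  -- + R). The same constant thus turns both the tail and the cutoff into decay in x.
  set D := (2 * (1 + R)) ^ e with hD
  have hD0 : 0 ≤ D := by positivity
  refine ⟨C * (P * D + U * D), by positivity, fun s hs x => ?_⟩
  have hx1 : 0 < 1 + ‖x‖ := by positivity
  have hkey : ∀ t : ℝ, 0 < t → 1 + ‖x‖ ≤ 2 * (1 + R) * t → t ^ (-e) ≤ D * (1 + ‖x‖) ^ (-e) := by
    intro t ht hxt
    rw [Real.rpow_neg ht.le, Real.rpow_neg hx1.le, hD, ← div_eq_mul_inv,
      ← Real.div_rpow (by positivity) hx1.le, ← Real.inv_rpow ht.le]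
    refine Real.rpow_le_rpow (by positivity) ?_ he0
    rw [inv_le_iff_one_le_mul₀ ht, div_mul_eq_mul_div, one_le_div hx1]
    exact hxt
  have hloc : (Metric.closedBall (0 : Space N) (R + 1)).indicator (fun _ => (1 : ℝ)) x ≤
      D * (1 + ‖x‖) ^ (-e) := by
    by_cases h : x ∈ Metric.closedBall (0 : Space N) (R + 1)
    · rw [indicator_of_mem h]
      rw [mem_closedBall_zero_iff] at h
      have := hkey 1 one_pos (by linarith)
      rwa [Real.one_rpow] at this
    · rw [indicator_of_notMem h]
      positivity
  have htail : ∀ y, |u y| * max 1 ‖x - y‖ ^ (-(N : ℝ) - 2 * 0 + β) ≤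
      |u y| * (D * (1 + ‖x‖) ^ (-e)) := by
    intro y
    rw [show -(N : ℝ) - 2 * 0 + β = -e by rw [he]; ring]
    by_cases hy : R < ‖y‖
    · simp [hR y hy]
    · rw [not_lt] at hy
      refine mul_le_mul_of_nonneg_left (hkey _ (by positivity) ?_) (abs_nonneg _)
      have h1 := le_max_left 1 ‖x - y‖
      have h2 := le_max_right 1 ‖x - y‖
      have h3 := norm_sub_norm_le x y
      nlinarith
  have hi1 := (integrable_localProfile_norm_sub hN hγ x).const_mul
    ((Metric.closedBall (0 : Space N) (R + 1)).indicator (fun _ => (1 : ℝ)) x)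
  calc |powLogIntegral j u s x| ≤ ∫ y, C *
        ((Metric.closedBall (0 : Space N) (R + 1)).indicator (fun _ => (1 : ℝ)) x *
          localProfile N (a - 2 * δ - β) ‖x - y‖ + |u y| * (D * (1 + ‖x‖) ^ (-e))) := by
        refine norm_integral_le_of_norm_le (f := powLogIntegrand j u s x) ((hi1.add (hUi.mul_const _)).const_mul C)
          (ae_of_all _ fun y => (hC s hs x y).trans ?_)
        exact mul_le_mul_of_nonneg_left (add_le_add_right (htail y) _) hC0
    _ = C * ((Metric.closedBall (0 : Space N) (R + 1)).indicator (fun _ => (1 : ℝ)) x * P +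
          U * (D * (1 + ‖x‖) ^ (-e))) := by
        rw [integral_const_mul, integral_add hi1 (hUi.mul_const _), integral_const_mul,
          integral_mul_const, hP,
          integral_sub_left_eq_self (fun z : Space N => localProfile N (a - 2 * δ - β) ‖z‖)]
    _ ≤ C * ((D * (1 + ‖x‖) ^ (-e)) * P + U * (D * (1 + ‖x‖) ^ (-e))) := by gcongr
    _ = C * (P * D + U * D) * (1 + ‖x‖) ^ (-e) := by ring

end Hoelder

/-! ### Smoothness of the Gamma-function coefficients -/

/-- The complex Gamma function is holomorphic, hence analytic, on the right half-plane; restrict to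
the real axis. -/
theorem contDiffAt_Gamma {x : ℝ} (hx : 0 < x) {n : WithTop ℕ∞} : ContDiffAt ℝ n Real.Gamma x := by
  have hopen : IsOpen {z : ℂ | 0 < z.re} := isOpen_lt continuous_const Complex.continuous_re
  have hd : DifferentiableOn ℂ Complex.Gamma {z : ℂ | 0 < z.re} := fun z hz =>
    (Complex.differentiableAt_Gamma z fun m hm => by
      have hz : 0 < z.re := hz
      rw [hm] at hz
      simp only [Complex.neg_re, Complex.natCast_re] at hz
      linarith [(Nat.cast_nonneg m : (0 : ℝ) ≤ m)]).differentiableWithinAt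
  have h := (hd.analyticAt (hopen.mem_nhds (show (x : ℂ) ∈ {z : ℂ | 0 < z.re} by
    simpa using hx))).contDiffAt (n := n)
  exact h.real_of_complex

theorem contDiffAt_two_rpow {f : ℝ → ℝ} {s : ℝ} {n : WithTop ℕ∞} (hf : ContDiffAt ℝ n f s) :
    ContDiffAt ℝ n (fun s => (2 : ℝ) ^ f s) s :=
  contDiffAt_const.rpow hf two_ne_zero

theorem contDiffAt_Gamma_quotient {N : ℕ} {s : ℝ} (hs : 2 * s < N) (hs' : -1 < s)
    {n : WithTop ℕ∞} :
    ContDiffAt ℝ n (fun s => Real.Gamma (((N : ℝ) - 2 * s) / 2)) s ∧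
      ContDiffAt ℝ n (fun s => Real.Gamma (1 + s)) s := by
  constructor
  · exact (contDiffAt_Gamma (x := ((N : ℝ) - 2 * s) / 2) (by linarith)).comp s
      (f := fun s : ℝ => ((N : ℝ) - 2 * s) / 2) (by fun_prop)
  · exact (contDiffAt_Gamma (x := 1 + s) (by linarith)).comp s
      (f := fun s : ℝ => 1 + s) (by fun_prop)

theorem contDiffAt_kappa1 {N : ℕ} {s : ℝ} (hs : 2 * s < N) (hs' : -1 < s) {n : WithTop ℕ∞} :
    ContDiffAt ℝ n (kappa1 N) s := by
  obtain ⟨h1, h2⟩ := contDiffAt_Gamma_quotient hs hs' (n := n)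
  exact ((contDiffAt_two_rpow (by fun_prop)).mul contDiffAt_const).mul
    (h1.div h2 (Real.Gamma_pos_of_pos (by linarith)).ne')

theorem contDiffAt_kappa2 {N : ℕ} (hN : 1 ≤ N) {s : ℝ} (hs : 2 * s < N) (hs' : -1 < s)
    {n : WithTop ℕ∞} : ContDiffAt ℝ n (kappa2 N) s := by
  obtain ⟨h1, h2⟩ := contDiffAt_Gamma_quotient hs hs' (n := n)
  have hN' : (0 : ℝ) < N := by exact_mod_cast hN
  exact (contDiffAt_two_rpow (by fun_prop)).mul (h1.div (contDiffAt_const.mul h2)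
    (mul_pos (Real.Gamma_pos_of_pos (by linarith)) (Real.Gamma_pos_of_pos (by linarith))).ne')

theorem kappa2_zero {N : ℕ} (hN : 1 ≤ N) : kappa2 N 0 = 1 := by
  have hN' : (0 : ℝ) < N := by exact_mod_cast hN
  have := (Real.Gamma_pos_of_pos (half_pos hN')).ne'
  simp [kappa2, this]

theorem fracConst_eq_mul_kappa1 (N : ℕ) (s : ℝ) : fracConst N s = s * kappa1 N (-s) := by
  rw [fracConst, kappa1, show -(2 * -s) = 2 * s by ring, show (N : ℝ) - 2 * -s = N + 2 * s by ring,
    ← sub_eq_add_neg]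
  ring

/-! ### Explicit tail integral and the splitting at distance one -/

section TailKernel

variable {N : ℕ} {s : ℝ}

theorem pow_smul_tail_indicator (hN : 1 ≤ N) {t : ℝ} (ht : 0 < t) :
    t ^ (N - 1) • (Ici (1 : ℝ)).indicator (fun t => t ^ (-(N : ℝ) - 2 * s)) t =
      (Ici (1 : ℝ)).indicator (fun t => t ^ (-1 - 2 * s)) t := by
  simp only [indicator_apply, smul_eq_mul]
  split_ifs
  · rw [← Real.rpow_natCast, ← Real.rpow_add ht, Nat.cast_sub hN]
    congr 1
    push_cast
    ring
  · simp

theorem integrable_tail_norm (hN : 1 ≤ N) (hs : 0 < s) :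
    Integrable fun z : Space N => (Ici (1 : ℝ)).indicator (fun t => t ^ (-(N : ℝ) - 2 * s)) ‖z‖ := by
  have : Nonempty (Fin N) := ⟨⟨0, hN⟩⟩
  rw [integrable_fun_norm_addHaar volume
    (f := (Ici (1 : ℝ)).indicator (fun t => t ^ (-(N : ℝ) - 2 * s))), finrank_euclideanSpace_fin]
  have hI : IntegrableOn ((Ici (1 : ℝ)).indicator fun t => t ^ (-1 - 2 * s)) (Ioi 0) := by
    rw [IntegrableOn, integrable_indicator_iff measurableSet_Ici, IntegrableOn,
      Measure.restrict_restrict measurableSet_Ici,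
      inter_eq_left.2 (Ici_subset_Ioi.2 one_pos), ← IntegrableOn, integrableOn_Ici_iff_integrableOn_Ioi]
    exact integrableOn_Ioi_rpow_of_lt (by linarith) one_pos
  exact hI.congr_fun (fun t ht => (pow_smul_tail_indicator hN ht).symm) measurableSet_Ioi

/-- The radial integral is 1/(2s) and the sphere has area N |B_1|; the factor s in c_{N,s} cancels
the pole at s = 0. -/
theorem fracConst_mul_integral_tail_norm (hN : 1 ≤ N) (hs : 0 < s) :
    fracConst N s *
      ∫ z : Space N, (Ici (1 : ℝ)).indicator (fun t => t ^ (-(N : ℝ) - 2 * s)) ‖z‖ =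
      kappa2 N (-s) := by
  have : Nonempty (Fin N) := ⟨⟨0, hN⟩⟩
  have hN' : (0 : ℝ) < N := by exact_mod_cast hN
  have hint : ∫ t in Ioi (0 : ℝ), t ^ (N - 1) •
      (Ici (1 : ℝ)).indicator (fun t => t ^ (-(N : ℝ) - 2 * s)) t = 1 / (2 * s) := by
    rw [setIntegral_congr_fun measurableSet_Ioi fun t ht => pow_smul_tail_indicator hN ht,
      setIntegral_indicator measurableSet_Ici, inter_eq_right.2 (Ici_subset_Ioi.2 one_pos),
      integral_Ici_eq_integral_Ioi, integral_Ioi_rpow_of_lt (by linarith) one_pos, Real.one_rpow]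
    rw [show -1 - 2 * s + 1 = -(2 * s) by ring, neg_div_neg_eq]
  have hG := (Real.Gamma_pos_of_pos (half_pos hN')).ne'
  have hvol : (volume : Measure (Space N)).real (Metric.ball 0 1) =
      Real.pi ^ ((N : ℝ) / 2) / (N / 2 * Real.Gamma (N / 2)) := by
    rw [measureReal_def, EuclideanSpace.volume_ball, Fintype.card_fin, ENNReal.ofReal_one, one_pow,
      one_mul, ENNReal.toReal_ofReal (by
        have := Real.Gamma_pos_of_pos (show 0 < (N : ℝ) / 2 + 1 by positivity)
        positivity), Real.Gamma_add_one (by positivity), Real.sqrt_eq_rpow, ← Real.rpow_natCast,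
      ← Real.rpow_mul Real.pi_pos.le]
    congr 2
    ring
  rw [integral_fun_norm_addHaar volume
    (f := (Ici (1 : ℝ)).indicator (fun t => t ^ (-(N : ℝ) - 2 * s))), finrank_euclideanSpace_fin,
    hint, hvol, fracConst_eq_mul_kappa1, kappa1, kappa2, nsmul_eq_mul, smul_eq_mul, neg_div,
    Real.rpow_neg Real.pi_pos.le]
  have hpi : Real.pi ^ ((N : ℝ) / 2) ≠ 0 := (Real.rpow_pos_of_pos Real.pi_pos _).ne'
  field_simp

theorem fracIntegrand_eq (s : ℝ) (u : Space N → ℝ) (x y : Space N) :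
    fracIntegrand s u x y = powLogIntegrand 0 u s x y +
      u x * (Ici (1 : ℝ)).indicator (fun t => t ^ (-(N : ℝ) - 2 * s)) ‖x - y‖ := by
  rw [fracIntegrand, powLogIntegrand, powLogKernel, pow_zero, mul_one, div_eq_mul_inv,
    ← Real.rpow_neg (norm_nonneg _), neg_add, ← sub_eq_add_neg]
  by_cases h : ‖x - y‖ < 1
  · rw [indicator_of_mem (mem_ball_iff_norm'.2 h), indicator_of_notMem (by simpa using h)]
    ring
  · rw [indicator_of_notMem (by rwa [mem_ball_iff_norm']),
      indicator_of_mem (by simpa using h)]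
    ring

end TailKernel

/-! ### Closed form and its derivatives at zero -/

/-- The closed form of `s ↦ (-Δ)^s u(x)`, which is meaningful also for `s ≤ 0`. -/
def fracExtension {N : ℕ} (u : Space N → ℝ) (x : Space N) (s : ℝ) : ℝ :=
  kappa2 N (-s) * u x + s * kappa1 N (-s) * powLogIntegral 0 u s x

theorem zeroOrderIntegrand_succ {N : ℕ} (j : ℕ) (u : Space N → ℝ) (x : Space N) :
    zeroOrderIntegrand (j + 1) u x = powLogIntegrand j u 0 x := by
  ext y
  rw [zeroOrderIntegrand, powLogIntegrand, kernelQ, powLogKernel, mul_zero, sub_zero,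
    Real.rpow_neg (norm_nonneg _), Real.rpow_natCast, Nat.add_sub_cancel]

theorem zeroOrderOp_succ {N : ℕ} (j : ℕ) (u : Space N → ℝ) (x : Space N) :
    zeroOrderOp (j + 1) u x = powLogIntegral j u 0 x := by
  rw [zeroOrderOp, if_neg j.succ_ne_zero, zeroOrderIntegrand_succ, powLogIntegral]

theorem iteratedDeriv_eqOn_of_hasDerivAt {f : ℕ → ℝ → ℝ} {U : Set ℝ} (hU : IsOpen U)
    (hf : ∀ j, ∀ s ∈ U, HasDerivAt (f j) (f (j + 1) s) s) (n : ℕ) :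
    EqOn (iteratedDeriv n (f 0)) (f n) U := by
  induction n with
  | zero => simp [eqOn_refl]
  | succ n ih =>
    intro s hs
    rw [iteratedDeriv_succ, (ih.eventuallyEq_of_mem (hU.mem_nhds hs)).deriv_eq, (hf n s hs).deriv]

theorem contDiffOn_of_hasDerivAt {f : ℕ → ℝ → ℝ} {U : Set ℝ} (hU : IsOpen U)
    (hf : ∀ j, ∀ s ∈ U, HasDerivAt (f j) (f (j + 1) s) s) (n : ℕ) : ContDiffOn ℝ n (f 0) U := by
  refine contDiffOn_of_differentiableOn_deriv (n := (n : ℕ∞)) fun m _ => ?_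
  have h : EqOn (iteratedDerivWithin m (f 0) U) (f m) U :=
    (iteratedDerivWithin_of_isOpen hU).trans (iteratedDeriv_eqOn_of_hasDerivAt hU hf m)
  exact DifferentiableOn.congr
    (fun s hs => (hf m s hs).differentiableAt.differentiableWithinAt) h

/-- At 0 only the first derivative of the factor s survives in the Leibniz sum; the sign comes from
the reflection s ↦ -s. -/
theorem iteratedDeriv_mul_kappa1_neg_zero {N : ℕ} (hN : 1 ≤ N) (i : ℕ) :
    iteratedDeriv (i + 1) (fun s => s * kappa1 N (-s)) 0 =
      (i + 1) * (-1) ^ i * iteratedDeriv i (kappa1 N) 0 := by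
  have hN' : (0 : ℝ) < N := by exact_mod_cast hN
  have hk : ContDiffAt ℝ ((i + 1 : ℕ) : WithTop ℕ∞) (fun s => kappa1 N (-s)) 0 :=
    (contDiffAt_kappa1 (s := -0) (by simpa using hN') (by simp)).comp 0
      (f := fun s : ℝ => -s) (by fun_prop)
  rw [iteratedDeriv_fun_mul (by fun_prop) hk, Finset.sum_eq_single 1]
  · rw [iteratedDeriv_fun_id, iteratedDeriv_comp_neg]
    simp
    ring
  · intro k _ hk1
    rw [iteratedDeriv_fun_id, if_neg hk1]
    simp
  · intro h
    simp at h

section Hoelder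

variable {N : ℕ} {u : Space N → ℝ} {a H R : ℝ}

/-- For 0 < 2s < a the full integral converges absolutely, so the limit ε → 0 merely drops the
integral over a ball of vanishing volume. -/
theorem fracLaplaceExists_and_eq (hN : 1 ≤ N) (hH : 0 ≤ H)
    (hu : ∀ x y, |u x - u y| ≤ H * ‖x - y‖ ^ a) (hR : ∀ x, R < ‖x‖ → u x = 0)
    (huc : Continuous u) (hus : HasCompactSupport u) {s : ℝ} (hs0 : 0 < s) (hs : 2 * s < a)
    (x : Space N) : FracLaplaceExists s u x ∧ fracLaplace s u x = fracExtension u x s := by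
  have : Nonempty (Fin N) := ⟨⟨0, hN⟩⟩
  have hi1 := integrable_powLogIntegrand hN hH hu hR huc hus 0 hs x
  have hi2 := ((integrable_tail_norm hN hs0).comp_sub_left x).const_mul (u x)
  have heq : fracIntegrand s u x = fun y => powLogIntegrand 0 u s x y +
      u x * (Ici (1 : ℝ)).indicator (fun t => t ^ (-(N : ℝ) - 2 * s)) ‖x - y‖ :=
    funext fun y => fracIntegrand_eq s u x y
  have hi : Integrable (fracIntegrand s u x) := by
    rw [heq]
    exact hi1.add hi2
  have hball : Tendsto (fun ε => ∫ y in Metric.ball x ε, fracIntegrand s u x y)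
      (𝓝[>] (0 : ℝ)) (𝓝 0) := by
    refine hi.tendsto_setIntegral_nhds_zero ?_
    have hc : Tendsto (fun ε : ℝ => ENNReal.ofReal ε ^ N *
        ENNReal.ofReal (√Real.pi ^ N / Real.Gamma ((N : ℝ) / 2 + 1))) (𝓝[>] (0 : ℝ)) (𝓝 0) := by
      have h1 : Tendsto (fun ε : ℝ => ENNReal.ofReal ε ^ N) (𝓝[>] (0 : ℝ)) (𝓝 0) := by
        have h2 : Tendsto (fun ε : ℝ => ENNReal.ofReal ε) (𝓝[>] (0 : ℝ)) (𝓝 (ENNReal.ofReal 0)) :=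
          (ENNReal.continuous_ofReal.tendsto 0).mono_left nhdsWithin_le_nhds
        have h3 := ((ENNReal.continuous_pow N).tendsto _).comp h2
        rwa [ENNReal.ofReal_zero, zero_pow (by omega)] at h3
      simpa using ENNReal.Tendsto.mul_const h1 (Or.inr ENNReal.ofReal_ne_top)
    refine hc.congr fun ε => ?_
    simp [EuclideanSpace.volume_ball]
  have hlim : Tendsto (fracTruncated s u x) (𝓝[>] (0 : ℝ)) (𝓝 (fracExtension u x s)) := by
    have h1 := (hball.const_sub (∫ y, fracIntegrand s u x y)).const_mul (fracConst N s)
    have hval : fracConst N s * ((∫ y, fracIntegrand s u x y) - 0) = fracExtension u x s := by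
      rw [sub_zero, heq, integral_add hi1 hi2, integral_const_mul, integral_sub_left_eq_self
        (fun z : Space N => (Ici (1 : ℝ)).indicator (fun t => t ^ (-(N : ℝ) - 2 * s)) ‖z‖),
        fracExtension, ← fracConst_mul_integral_tail_norm hN hs0, ← fracConst_eq_mul_kappa1,
        powLogIntegral]
      ring
    rw [← hval]
    refine h1.congr fun ε => ?_
    rw [fracTruncated, ← integral_add_compl (measurableSet_ball (x := x) (ε := ε)) hi,
      add_sub_cancel_left]
  exact ⟨⟨fun ε _ => hi.integrableOn, _, hlim⟩, hlim.limUnder_eq⟩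

/-- The bound s > -1/2 keeps N + 2s positive for every N ≥ 1, and s < 1 keeps Γ(1 - s) away from its
poles. -/
theorem contDiffAt_kappa_neg (hN : 1 ≤ N) {s : ℝ} (hs : -(1 / 2) < s) (hs' : s < 1)
    {n : WithTop ℕ∞} :
    ContDiffAt ℝ n (fun s => kappa2 N (-s)) s ∧ ContDiffAt ℝ n (fun s => s * kappa1 N (-s)) s := by
  have hN' : (1 : ℝ) ≤ N := by exact_mod_cast hN
  exact ⟨(contDiffAt_kappa2 hN (s := -s) (by linarith) (by linarith)).comp s
      (f := fun s : ℝ => -s) (by fun_prop),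
    contDiffAt_id.mul ((contDiffAt_kappa1 (s := -s) (by linarith) (by linarith)).comp s
      (f := fun s : ℝ => -s) (by fun_prop))⟩

theorem contDiffAt_powLogIntegral (hN : 1 ≤ N) (hH : 0 ≤ H)
    (hu : ∀ x y, |u x - u y| ≤ H * ‖x - y‖ ^ a) (hR : ∀ x, R < ‖x‖ → u x = 0)
    (huc : Continuous u) (hus : HasCompactSupport u) {s : ℝ} (hs : 2 * s < a) (x : Space N)
    (n : ℕ) : ContDiffAt ℝ n (fun s => powLogIntegral 0 u s x) s :=
  (contDiffOn_of_hasDerivAt (f := fun j s => powLogIntegral j u s x) (isOpen_Iio (a := a / 2))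
    (fun j s hs => hasDerivAt_powLogIntegral hN hH hu hR huc hus j
      (by have : s < a / 2 := hs; linarith) x) n).contDiffAt
    (Iio_mem_nhds (by linarith))

theorem contDiffAt_fracExtension (hN : 1 ≤ N) (hH : 0 ≤ H)
    (hu : ∀ x y, |u x - u y| ≤ H * ‖x - y‖ ^ a) (hR : ∀ x, R < ‖x‖ → u x = 0)
    (huc : Continuous u) (hus : HasCompactSupport u) {s : ℝ} (hs0 : -(1 / 2) < s) (hs1 : s < 1)
    (hs : 2 * s < a) (x : Space N) (n : ℕ) : ContDiffAt ℝ n (fracExtension u x) s := by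
  obtain ⟨h1, h2⟩ := contDiffAt_kappa_neg hN hs0 hs1 (n := n)
  exact (h1.mul contDiffAt_const).add
    (h2.mul (contDiffAt_powLogIntegral hN hH hu hR huc hus hs x n))

theorem iteratedDeriv_fracExtension (hN : 1 ≤ N) (hH : 0 ≤ H)
    (hu : ∀ x y, |u x - u y| ≤ H * ‖x - y‖ ^ a) (hR : ∀ x, R < ‖x‖ → u x = 0)
    (huc : Continuous u) (hus : HasCompactSupport u) {s : ℝ} (hs0 : -(1 / 2) < s) (hs1 : s < 1)
    (hs : 2 * s < a) (x : Space N) (n : ℕ) :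
    iteratedDeriv n (fracExtension u x) s =
      iteratedDeriv n (fun s => kappa2 N (-s)) s * u x +
        ∑ i ∈ Finset.range (n + 1), (n.choose i : ℝ) *
          iteratedDeriv i (fun s => s * kappa1 N (-s)) s * powLogIntegral (n - i) u s x := by
  obtain ⟨h1, h2⟩ := contDiffAt_kappa_neg hN hs0 hs1 (n := n)
  have h3 := contDiffAt_powLogIntegral hN hH hu hR huc hus hs x n
  have h4 : ∀ i, iteratedDeriv i (fun s => powLogIntegral 0 u s x) s = powLogIntegral i u s x :=
    fun i => iteratedDeriv_eqOn_of_hasDerivAt (f := fun j s => powLogIntegral j u s x)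
      (isOpen_Iio (a := a / 2)) (fun j s hs => hasDerivAt_powLogIntegral hN hH hu hR huc hus j
      (by have : s < a / 2 := hs; linarith) x) i (show s < a / 2 by linarith)
  unfold fracExtension
  rw [iteratedDeriv_fun_add (h1.mul contDiffAt_const) (h2.mul h3), iteratedDeriv_mul_const_field,
    iteratedDeriv_fun_mul h2 h3]
  simp only [h4]

theorem iteratedDeriv_fracExtension_zero (hN : 1 ≤ N) (ha : 0 < a) (hH : 0 ≤ H)
    (hu : ∀ x y, |u x - u y| ≤ H * ‖x - y‖ ^ a) (hR : ∀ x, R < ‖x‖ → u x = 0)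
    (huc : Continuous u) (hus : HasCompactSupport u) (x : Space N) {m : ℕ} (hm : 1 ≤ m) :
    iteratedDeriv m (fracExtension u x) 0 = logLaplace m u x := by
  obtain ⟨k, rfl⟩ : ∃ k, m = k + 1 := ⟨m - 1, by omega⟩
  rw [iteratedDeriv_fracExtension hN hH hu hR huc hus (by norm_num) one_pos (by linarith) x,
    logLaplace, Finset.sum_range_succ', Finset.sum_range_succ' _ (k + 1), add_comm]
  congr 1
  -- The undifferentiated factor s κ₁(-s) vanishes at 0, so no m-th derivative of I appears;
  -- reversing the sum matches the order of the K_{j+1}.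
  · rw [iteratedDeriv_zero, zero_mul, mul_zero, zero_mul, add_zero, ← Finset.sum_range_reflect]
    refine Finset.sum_congr rfl fun j hj => ?_
    have hj : j ≤ k := by simpa [Nat.lt_succ_iff] using hj
    rw [iteratedDeriv_mul_kappa1_neg_zero hN, logCoeff, if_neg j.succ_ne_zero, zeroOrderOp_succ]
    have e1 : k + 1 - 1 - j = k - j := by omega
    have e2 : k + 1 - (k - j + 1) = j := by omega
    have e3 : k + 1 - (j + 1) = k - j := by omega
    have e4 : k + 1 - 1 = k := rfl
    -- This absorption identity converts the Leibniz binomial into the factor m (m-1 choose j-1) of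
    -- α_j, with j shifted by one.
    have hch : (((k + 1).choose (k - j + 1) : ℕ) : ℝ) * (((k - j : ℕ) : ℝ) + 1) =
        ((k + 1 : ℕ) : ℝ) * (k.choose j : ℝ) := by
      have := Nat.add_one_mul_choose_eq k (k - j)
      rw [Nat.choose_symm hj] at this
      exact_mod_cast this.symm
    have hsign : (-1 : ℝ) ^ (k + 1 + (j + 1)) = (-1) ^ (k - j) := by
      rw [show k + 1 + (j + 1) = (k - j) + 2 * (j + 1) by omega, pow_add, pow_mul]
      simp
    rw [e1, e2, e3, e4, Nat.add_sub_cancel, hsign]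
    linear_combination (-1) ^ (k - j) * iteratedDeriv (k - j) (kappa1 N) 0 *
      powLogIntegral j u 0 x * hch
  · rw [iteratedDeriv_comp_neg, logCoeff, if_pos rfl, zeroOrderOp, if_pos rfl]
    simp

theorem fracExtension_zero (hN : 1 ≤ N) (u : Space N → ℝ) (x : Space N) :
    fracExtension u x 0 = u x := by
  simp [fracExtension, kappa2_zero hN]

end Hoelder

/-! ### Uniform decay, Taylor remainder and L^p convergence -/

theorem continuousAt_iteratedDeriv {f : ℝ → ℝ} {s : ℝ} {n : ℕ} (h : ContDiffAt ℝ n f s) :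
    ContinuousAt (iteratedDeriv n f) s := by
  rw [iteratedDeriv_eq_equiv_comp]
  exact (LinearIsometryEquiv.continuous _).continuousAt.comp (h.continuousAt_iteratedFDeriv le_rfl)

theorem exists_abs_iteratedDeriv_le {f : ℝ → ℝ} {b : ℝ} (n : ℕ)
    (h : ∀ s ∈ Icc 0 b, ContDiffAt ℝ n f s) :
    ∃ C : ℝ, 0 ≤ C ∧ ∀ s ∈ Icc 0 b, |iteratedDeriv n f s| ≤ C := by
  obtain ⟨C, hC⟩ := isCompact_Icc.exists_bound_of_continuousOn (f := iteratedDeriv n f)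
    fun s hs => (continuousAt_iteratedDeriv (h s hs)).continuousWithinAt
  exact ⟨max C 0, le_max_right _ _, fun s hs => (hC s hs).trans (le_max_left _ _)⟩

theorem exists_abs_le_mul_one_add_norm_rpow {N : ℕ} {u : Space N → ℝ} (huc : Continuous u)
    (hus : HasCompactSupport u) (e : ℝ) :
    ∃ C : ℝ, 0 ≤ C ∧ ∀ x, |u x| ≤ C * (1 + ‖x‖) ^ (-e) := by
  have hc : Continuous fun x : Space N => (1 + ‖x‖) ^ e :=
    Continuous.rpow_const (by fun_prop) fun x => Or.inl (by positivity)
  obtain ⟨C, hC⟩ := (huc.mul hc).bounded_above_of_compact_support (hus.mul_right)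
  refine ⟨max C 0, le_max_right _ _, fun x => ?_⟩
  have hx : 0 < 1 + ‖x‖ := by positivity
  rw [Real.rpow_neg hx.le, ← div_eq_mul_inv, le_div_iff₀ (by positivity)]
  have := (hC x).trans (le_max_left C 0)
  rwa [Real.norm_eq_abs, Pi.mul_apply, abs_mul, abs_of_pos (Real.rpow_pos_of_pos hx e)] at this

/-- For finite p, integrability needs (N - β) p > N, that is β < N (1 - 1/p), which leaves room
exactly because p > 1. For p = ∞ boundedness suffices, so β ≤ N is enough. -/
theorem exists_memLp_one_add_norm_rpow {N : ℕ} (hN : 1 ≤ N) {p : ℝ≥0∞} (hp : 1 < p) {c : ℝ}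
    (hc : 0 < c) : ∃ β : ℝ, 0 < β ∧ β ≤ N ∧ β ≤ c ∧
      MemLp (fun x : Space N => (1 + ‖x‖) ^ (-((N : ℝ) - β))) p volume := by
  have hN' : (0 : ℝ) < N := by exact_mod_cast hN
  have hcont : ∀ e : ℝ, Continuous fun x : Space N => (1 + ‖x‖) ^ e := fun e =>
    Continuous.rpow_const (by fun_prop) fun x => Or.inl (by positivity)
  rcases eq_or_ne p ⊤ with rfl | hpt
  · refine ⟨min N c, lt_min hN' hc, min_le_left _ _, min_le_right _ _,
      memLp_top_of_bound (hcont _).aestronglyMeasurable 1 (ae_of_all _ fun x => ?_)⟩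
    rw [Real.norm_of_nonneg (by positivity)]
    exact Real.rpow_le_one_of_one_le_of_nonpos (by linarith [norm_nonneg x])
      (by linarith [min_le_left (N : ℝ) c])
  · have hp1 : 1 < p.toReal := by
      rw [← ENNReal.toReal_one]
      exact (ENNReal.toReal_lt_toReal ENNReal.one_ne_top hpt).2 hp
    have hq : 0 < (N : ℝ) * (1 - 1 / p.toReal) := by
      refine mul_pos hN' (sub_pos.2 ?_)
      rwa [div_lt_one (by linarith)]
    obtain ⟨β, hβ0, hβ⟩ := exists_between (lt_min hq hc)
    have hβ1 := hβ.trans_le (min_le_left _ _)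
    have hβ2 : β * p.toReal < N * (p.toReal - 1) := by
      have h := mul_lt_mul_of_pos_right hβ1 (by linarith : 0 < p.toReal)
      have h2 : (N : ℝ) * (1 - 1 / p.toReal) * p.toReal = N * (p.toReal - 1) := by
        field_simp
      rwa [h2] at h
    have hβN : β ≤ N := by
      have : (N : ℝ) * (1 - 1 / p.toReal) ≤ N * 1 := by
        gcongr
        have : 0 < 1 / p.toReal := by positivity
        linarith
      linarith
    refine ⟨β, hβ0, hβN, (hβ.trans_le (min_le_right _ _)).le, ?_⟩
    rw [← integrable_norm_rpow_iff (hcont _).aestronglyMeasurable (by positivity) hpt]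
    have hint := integrable_one_add_norm (E := Space N) (μ := volume)
      (r := ((N : ℝ) - β) * p.toReal) (by
        rw [finrank_euclideanSpace_fin]
        nlinarith)
    refine hint.congr (ae_of_all _ fun x => ?_)
    have hx : 0 ≤ 1 + ‖x‖ := by positivity
    beta_reduce
    rw [Real.norm_of_nonneg (by positivity), ← Real.rpow_mul hx, neg_mul]

section Hoelder

variable {N : ℕ} {u : Space N → ℝ} {a H R : ℝ}

/-- Decay of the derivatives of `fracExtension` at infinity, uniformly for `s ∈ [0, b]`. -/
theorem exists_abs_iteratedDeriv_fracExtension_le (hN : 1 ≤ N) (hH : 0 ≤ H)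
    (hu : ∀ x y, |u x - u y| ≤ H * ‖x - y‖ ^ a) (hR0 : 0 ≤ R) (hR : ∀ x, R < ‖x‖ → u x = 0)
    (huc : Continuous u) (hus : HasCompactSupport u) {β b : ℝ} (hβ : 0 < β) (hβN : β ≤ N)
    (hb1 : b < 1) (hb : 2 * b + β < a) (n : ℕ) :
    ∃ C : ℝ, 0 ≤ C ∧ ∀ s ∈ Icc 0 b, ∀ x : Space N,
      |iteratedDeriv n (fracExtension u x) s| ≤ C * (1 + ‖x‖) ^ (-((N : ℝ) - β)) := by
  have hdom : ∀ s ∈ Icc 0 b, -(1 / 2) < s ∧ s < 1 := fun s hs =>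
    ⟨by linarith [hs.1], by linarith [hs.2]⟩
  obtain ⟨A, hA0, hA⟩ := exists_abs_iteratedDeriv_le (b := b) n fun s hs =>
    (contDiffAt_kappa_neg hN (hdom s hs).1 (hdom s hs).2).1
  obtain ⟨M, hM0, hM⟩ := exists_abs_le_mul_one_add_norm_rpow huc hus ((N : ℝ) - β)
  choose B hB0 hB using fun i : ℕ => exists_abs_iteratedDeriv_le (b := b) i fun s hs =>
    (contDiffAt_kappa_neg hN (hdom s hs).1 (hdom s hs).2).2
  choose D hD0 hD using fun j =>
    exists_abs_powLogIntegral_le hN hH hu hR0 hR huc hus j hβ hβN hb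
  refine ⟨A * M + ∑ i ∈ Finset.range (n + 1), (n.choose i : ℝ) * B i * D (n - i), ?_,
    fun s hs x => ?_⟩
  · have := Finset.sum_nonneg fun i (_ : i ∈ Finset.range (n + 1)) =>
      mul_nonneg (mul_nonneg (Nat.cast_nonneg (α := ℝ) (n.choose i)) (hB0 i)) (hD0 (n - i))
    positivity
  rw [iteratedDeriv_fracExtension hN hH hu hR huc hus (hdom s hs).1 (hdom s hs).2
    (by linarith [hs.2]) x n, add_mul, Finset.sum_mul]
  refine (abs_add_le _ _).trans (add_le_add ?_ ((Finset.abs_sum_le_sum_abs _ _).trans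
    (Finset.sum_le_sum fun i _ => ?_)))
  · rw [abs_mul, mul_assoc]
    exact mul_le_mul (hA s hs) (hM x) (abs_nonneg _) hA0
  · rw [abs_mul, abs_mul, Nat.abs_cast, mul_assoc _ (D _)]
    have h1 := hB i s hs
    have h2 := hD (n - i) s hs x
    have h3 := hB0 i
    gcongr

/-- The Taylor remainder differs from its limit by `O(s)` times the `(m + 1)`-st derivative. -/
theorem abs_taylorRemainder_sub_logLaplace_le (hN : 1 ≤ N) (hH : 0 ≤ H)
    (hu : ∀ x y, |u x - u y| ≤ H * ‖x - y‖ ^ a) (hR : ∀ x, R < ‖x‖ → u x = 0)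
    (huc : Continuous u) (hus : HasCompactSupport u) {b : ℝ} (hb1 : b < 1)
    (hb : 2 * b < a) {m : ℕ} (hm : 1 ≤ m) (x : Space N) {K : ℝ}
    (hK : ∀ s ∈ Icc 0 b, |iteratedDeriv (m + 1) (fracExtension u x) s| ≤ K) {s : ℝ}
    (hs : s ∈ Ioc 0 b) :
    |taylorRemainder m u s x - logLaplace m u x| ≤ s * K := by
  have hb0 : 0 < b := hs.1.trans_le hs.2
  have hsm := hs.1
  have hC : ∀ (n : ℕ), ∀ t ∈ Icc 0 b, ContDiffAt ℝ n (fracExtension u x) t := fun n t ht =>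
    contDiffAt_fracExtension hN hH hu hR huc hus (by linarith [ht.1]) (by linarith [ht.2])
      (by linarith [ht.2]) x n
  -- The extension is smooth on both sides of 0, so one-sided derivatives at the endpoints agree
  -- with the ordinary ones.
  have hW : ∀ n, ∀ t ∈ Icc 0 b, iteratedDerivWithin n (fracExtension u x) (Icc 0 b) t =
      iteratedDeriv n (fracExtension u x) t := fun n t ht =>
    iteratedDerivWithin_eq_iteratedDeriv (uniqueDiffOn_Icc hb0) (hC n t ht) ht
  have h0 : (0 : ℝ) ∈ Icc 0 b := ⟨le_rfl, hb0.le⟩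
  have hT := taylor_mean_remainder_bound (f := fracExtension u x) (n := m) hb0.le
    (fun t ht => by exact_mod_cast (hC (m + 1) t ht).contDiffWithinAt) (Ioc_subset_Icc_self hs)
    (C := K) (fun t ht => by
      rw [hW _ t ht]
      exact hK t ht)
  have hpoly : taylorWithinEval (fracExtension u x) m (Icc 0 b) 0 s =
      u x + ∑ j ∈ Finset.Ico 1 m, s ^ j / (j.factorial : ℝ) * logLaplace j u x +
        s ^ m / (m.factorial : ℝ) * logLaplace m u x := by
    have hterm : ∀ j, 1 ≤ j → ((j.factorial : ℝ)⁻¹ * (s - 0) ^ j) •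
        iteratedDerivWithin j (fracExtension u x) (Icc 0 b) 0 =
          s ^ j / (j.factorial : ℝ) * logLaplace j u x := by
      intro j hj
      rw [hW j 0 h0, iteratedDeriv_fracExtension_zero hN (by linarith) hH hu hR huc hus x hj,
        smul_eq_mul, sub_zero]
      ring
    rw [taylor_within_apply, Finset.sum_range_succ, hterm m hm, Finset.range_eq_Ico,
      Finset.sum_eq_sum_Ico_succ_bot (by omega), zero_add,
      Finset.sum_congr rfl fun j hj => hterm j (Finset.mem_Ico.1 hj).1]
    simp [fracExtension_zero hN]
  rw [hpoly, sub_zero, Real.norm_eq_abs] at hT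
  have hfac : (0 : ℝ) < m.factorial := by positivity
  have hfs : fracLaplace s u x = fracExtension u x s :=
    (fracLaplaceExists_and_eq hN hH hu hR huc hus hs.1 (by linarith [hs.2]) x).2
  have hrw : taylorRemainder m u s x - logLaplace m u x = (m.factorial : ℝ) / s ^ m *
      (fracExtension u x s - (u x + ∑ j ∈ Finset.Ico 1 m, s ^ j / (j.factorial : ℝ) *
        logLaplace j u x + s ^ m / (m.factorial : ℝ) * logLaplace m u x)) := by
    rw [taylorRemainder, hfs]
    field_simp
    ring
  rw [hrw, abs_mul, abs_of_pos (by positivity : 0 < (m.factorial : ℝ) / s ^ m)]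
  calc (m.factorial : ℝ) / s ^ m * _ ≤ (m.factorial : ℝ) / s ^ m *
        (K * s ^ (m + 1) / m.factorial) := by gcongr
    _ = s * K := by
      field_simp
      ring

theorem stronglyMeasurable_logLaplace (huc : Continuous u) (m : ℕ) :
    StronglyMeasurable (logLaplace m u) := by
  refine Finset.stronglyMeasurable_fun_sum _ fun j _ => StronglyMeasurable.const_mul ?_ _
  rcases j with _ | j
  · exact huc.stronglyMeasurable
  · have : zeroOrderOp (j + 1) u = powLogIntegral j u 0 := funext fun x => zeroOrderOp_succ j u x
    rw [this]
    exact stronglyMeasurable_powLogIntegral j huc 0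

theorem stronglyMeasurable_taylorRemainder (hN : 1 ≤ N) (hH : 0 ≤ H)
    (hu : ∀ x y, |u x - u y| ≤ H * ‖x - y‖ ^ a) (hR : ∀ x, R < ‖x‖ → u x = 0)
    (huc : Continuous u) (hus : HasCompactSupport u) (m : ℕ) {s : ℝ} (hs0 : 0 < s)
    (hs : 2 * s < a) : StronglyMeasurable (taylorRemainder m u s) := by
  have h1 : fracLaplace s u = fun x => kappa2 N (-s) * u x +
      s * kappa1 N (-s) * powLogIntegral 0 u s x :=
    funext fun x => (fracLaplaceExists_and_eq hN hH hu hR huc hus hs0 hs x).2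
  have h2 : StronglyMeasurable (fracLaplace s u) := by
    rw [h1]
    exact (huc.stronglyMeasurable.const_mul _).add
      ((stronglyMeasurable_powLogIntegral 0 huc s).const_mul _)
  exact ((h2.sub huc.stronglyMeasurable).sub (Finset.stronglyMeasurable_fun_sum _ fun j _ =>
    (stronglyMeasurable_logLaplace huc j).const_mul _)).const_mul _

theorem memLp_and_tendsto_taylorRemainder (hN : 1 ≤ N) (ha : 0 < a) (hH : 0 ≤ H)
    (hu : ∀ x y, |u x - u y| ≤ H * ‖x - y‖ ^ a) (hR0 : 0 ≤ R) (hR : ∀ x, R < ‖x‖ → u x = 0)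
    (huc : Continuous u) (hus : HasCompactSupport u) {m : ℕ} (hm : 1 ≤ m) {p : ℝ≥0∞}
    (hp : 1 < p) :
    MemLp (logLaplace m u) p volume ∧
      (∀ᶠ s in 𝓝[>] (0 : ℝ), MemLp (taylorRemainder m u s) p volume) ∧
      Tendsto (fun s : ℝ => eLpNorm (fun x => taylorRemainder m u s x - logLaplace m u x) p volume)
        (𝓝[>] (0 : ℝ)) (𝓝 0) := by
  obtain ⟨β, hβ0, hβN, hβa, hΦ⟩ := exists_memLp_one_add_norm_rpow hN hp (c := a / 4) (by positivity)
  -- With β ≤ a/4 this gives 2b + β ≤ 3a/4 < a, the room needed for the uniform decay.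
  set b : ℝ := min (1 / 4) (a / 4) with hb
  have hb0 : 0 < b := by positivity
  have hb1 : b < 1 := (min_le_left _ _).trans_lt (by norm_num)
  have hba : b ≤ a / 4 := min_le_right _ _
  have hbβ : 2 * b + β < a := by linarith
  obtain ⟨C, hC0, hC⟩ := exists_abs_iteratedDeriv_fracExtension_le hN hH hu hR0 hR huc hus hβ0 hβN
    hb1 hbβ m
  obtain ⟨D, hD0, hD⟩ := exists_abs_iteratedDeriv_fracExtension_le hN hH hu hR0 hR huc hus hβ0 hβN
    hb1 hbβ (m + 1)
  have hL : MemLp (logLaplace m u) p volume := by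
    refine (hΦ.const_mul C).mono' (stronglyMeasurable_logLaplace huc m).aestronglyMeasurable
      (ae_of_all _ fun x => ?_)
    rw [← iteratedDeriv_fracExtension_zero hN ha hH hu hR huc hus x hm]
    exact hC 0 ⟨le_rfl, hb0.le⟩ x
  have hdiff : ∀ s ∈ Ioc 0 b, ∀ x, ‖taylorRemainder m u s x - logLaplace m u x‖ ≤
      s * (D * (1 + ‖x‖) ^ (-((N : ℝ) - β))) := fun s hs x =>
    abs_taylorRemainder_sub_logLaplace_le hN hH hu hR huc hus hb1 (by linarith) hm x
      (fun t ht => hD t ht x) hs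
  have hev : ∀ᶠ s in 𝓝[>] (0 : ℝ), s ∈ Ioc 0 b := Ioc_mem_nhdsGT hb0
  refine ⟨hL, ?_, ?_⟩
  · filter_upwards [hev] with s hs
    have h1 : MemLp (fun x => taylorRemainder m u s x - logLaplace m u x) p volume :=
      ((hΦ.const_mul D).const_mul s).mono'
        ((stronglyMeasurable_taylorRemainder hN hH hu hR huc hus m hs.1
          (by linarith [hs.2])).sub (stronglyMeasurable_logLaplace huc m)).aestronglyMeasurable
        (ae_of_all _ (hdiff s hs))
    convert h1.add hL using 1
    ext x
    simp
  · set E := eLpNorm (fun x : Space N => D * (1 + ‖x‖) ^ (-((N : ℝ) - β))) p volume with hE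
    have hEtop : E ≠ ⊤ := (hΦ.const_mul D).eLpNorm_ne_top
    have hlim : Tendsto (fun s : ℝ => ‖s‖ₑ * E) (𝓝[>] (0 : ℝ)) (𝓝 0) := by
      have h1 : Tendsto (fun s : ℝ => ‖s‖ₑ) (𝓝[>] (0 : ℝ)) (𝓝 0) := by
        have := (continuous_enorm (E := ℝ)).tendsto 0
        rw [enorm_zero] at this
        exact this.mono_left nhdsWithin_le_nhds
      simpa using ENNReal.Tendsto.mul_const h1 (Or.inr hEtop)
    refine tendsto_of_tendsto_of_tendsto_of_le_of_le' tendsto_const_nhds hlim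
      (Eventually.of_forall fun s => zero_le) ?_
    filter_upwards [hev] with s hs
    rw [hE, ← eLpNorm_const_smul]
    exact eLpNorm_mono_real (hdiff s hs)

theorem contDiffOn_and_tendsto_iteratedDeriv_fracLaplace (hN : 1 ≤ N) (ha : 0 < a) (hH : 0 ≤ H)
    (hu : ∀ x y, |u x - u y| ≤ H * ‖x - y‖ ^ a) (hR : ∀ x, R < ‖x‖ → u x = 0)
    (huc : Continuous u) (hus : HasCompactSupport u) {m : ℕ} (hm : 1 ≤ m) {δ : ℝ} (hδ0 : 0 < δ)
    (hδ1 : δ < 1) (hδ : 2 * δ < a) (x : Space N) :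
    ContDiffOn ℝ m (Function.update (fun s : ℝ => fracLaplace s u x) 0 (u x)) (Ico 0 δ) ∧
      iteratedDerivWithin m (Function.update (fun s : ℝ => fracLaplace s u x) 0 (u x))
        (Ico 0 δ) 0 = logLaplace m u x ∧
      Tendsto (iteratedDeriv m (fun s : ℝ => fracLaplace s u x)) (𝓝[>] (0 : ℝ))
        (𝓝 (logLaplace m u x)) := by
  have heq : ∀ s ∈ Ioo 0 δ, fracLaplace s u x = fracExtension u x s := fun s hs =>
    (fracLaplaceExists_and_eq hN hH hu hR huc hus hs.1 (by linarith [hs.2]) x).2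
  -- The prescribed value at 0 fits the closed form because κ₂(0) = 1.
  have hupd : EqOn (Function.update (fun s : ℝ => fracLaplace s u x) 0 (u x)) (fracExtension u x)
      (Ico 0 δ) := by
    intro s hs
    rcases eq_or_lt_of_le hs.1 with rfl | h0
    · rw [Function.update_self, fracExtension_zero hN]
    · rw [Function.update_of_ne h0.ne', heq s ⟨h0, hs.2⟩]
  have hC : ∀ s ∈ Ico 0 δ, ContDiffAt ℝ m (fracExtension u x) s := fun s hs =>
    contDiffAt_fracExtension hN hH hu hR huc hus (by linarith [hs.1]) (by linarith [hs.2])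
      (by linarith [hs.2]) x m
  have h0 : (0 : ℝ) ∈ Ico 0 δ := ⟨le_rfl, hδ0⟩
  have hval := iteratedDeriv_fracExtension_zero hN ha hH hu hR huc hus x hm
  refine ⟨ContDiffOn.congr (fun s hs => (hC s hs).contDiffWithinAt) hupd, ?_, ?_⟩
  · rw [iteratedDerivWithin_congr hupd h0,
      iteratedDerivWithin_eq_iteratedDeriv (uniqueDiffOn_Ico 0 δ) (hC 0 h0) h0, hval]
  · rw [← hval]
    refine ((continuousAt_iteratedDeriv (hC 0 h0)).tendsto.mono_left nhdsWithin_le_nhds).congr' ?_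
    filter_upwards [Ioo_mem_nhdsGT hδ0] with s hs
    exact (EqOn.iteratedDeriv_of_isOpen (fun t ht => heq t ht) isOpen_Ioo m hs).symm

end Hoelder

end LogLaplace

end

/-! ### The theorem -/

theorem theorem1p2 (N : ℕ) (hN : 1 ≤ N) (m : ℕ) (hm : 1 ≤ m)
    (α : ℝ≥0) (hα : 0 < α) (ζ : LogLaplace.Space N → ℝ)
    (hζ : ∃ C : ℝ≥0, HolderWith C α ζ) (hζc : HasCompactSupport ζ) :
    -- the integrals in the definition of `L_m ζ` converge absolutely
    (∀ x : LogLaplace.Space N, ∀ j : ℕ, 1 ≤ j → j ≤ m →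
      Integrable (LogLaplace.zeroOrderIntegrand j ζ x)) ∧
    -- `s ↦ (-Δ)^s ζ(x)`, with value `ζ(x)` at `s = 0`, is `C^m` on some `[0, δ)`;
    -- its `m`-th right derivative at `0` is `L_m ζ(x)`, and so is the limit of its
    -- `m`-th derivative as `s → 0⁺`
    (∃ δ : ℝ, 0 < δ ∧ δ ≤ 1 / 4 ∧ ∀ x : LogLaplace.Space N,
      (∀ s ∈ Ioo (0 : ℝ) δ, LogLaplace.FracLaplaceExists s ζ x) ∧
      ContDiffOn ℝ m (Function.update (fun s : ℝ => LogLaplace.fracLaplace s ζ x) 0 (ζ x))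
        (Ico 0 δ) ∧
      iteratedDerivWithin m
        (Function.update (fun s : ℝ => LogLaplace.fracLaplace s ζ x) 0 (ζ x)) (Ico 0 δ) 0 =
          LogLaplace.logLaplace m ζ x ∧
      Tendsto (iteratedDeriv m (fun s : ℝ => LogLaplace.fracLaplace s ζ x)) (𝓝[>] (0 : ℝ))
        (𝓝 (LogLaplace.logLaplace m ζ x))) ∧
    -- convergence of the normalized remainder in `L^p(ℝ^N)`, `1 < p ≤ ∞`
    (∀ p : ℝ≥0∞, 1 < p →
      MemLp (LogLaplace.logLaplace m ζ) p volume ∧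
      (∀ᶠ s in 𝓝[>] (0 : ℝ), MemLp (LogLaplace.taylorRemainder m ζ s) p volume) ∧
      Tendsto (fun s : ℝ => eLpNorm
          (fun x => LogLaplace.taylorRemainder m ζ s x - LogLaplace.logLaplace m ζ x) p volume)
        (𝓝[>] (0 : ℝ)) (𝓝 0)) := by
  obtain ⟨C, hC⟩ := hζ
  have hc : Continuous ζ := hC.continuous hα
  have hH : (0 : ℝ) ≤ C := C.2
  have ha : (0 : ℝ) < α := hα
  have hu : ∀ x y, |ζ x - ζ y| ≤ (C : ℝ) * ‖x - y‖ ^ (α : ℝ) := fun x y => by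
    simpa [Real.dist_eq, dist_eq_norm] using hC.dist_le x y
  obtain ⟨R, hR0, hRs⟩ := hζc.isCompact.isBounded.subset_closedBall_lt 0 0
  have hR : ∀ x, R < ‖x‖ → ζ x = 0 := fun x hx => by
    refine image_eq_zero_of_notMem_tsupport fun hxs => ?_
    have := mem_closedBall_zero_iff.1 (hRs hxs)
    linarith
  -- This δ is independent of x and gives 2δ ≤ α/2 < α.
  refine ⟨fun x j hj _ => ?_, ⟨min (1 / 4) (α / 4), by positivity, min_le_left _ _, fun x => ?_⟩,
    fun p hp => LogLaplace.memLp_and_tendsto_taylorRemainder hN ha hH hu hR0.le hR hc hζc hm hp⟩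
  · obtain ⟨k, rfl⟩ : ∃ k, j = k + 1 := ⟨j - 1, by omega⟩
    rw [LogLaplace.zeroOrderIntegrand_succ]
    exact LogLaplace.integrable_powLogIntegrand hN hH hu hR hc hζc k (by linarith) x
  · have h4 : min (1 / 4) ((α : ℝ) / 4) ≤ α / 4 := min_le_right _ _
    have h1 : min (1 / 4) ((α : ℝ) / 4) ≤ 1 / 4 := min_le_left _ _
    exact ⟨fun s hs => (LogLaplace.fracLaplaceExists_and_eq hN hH hu hR hc hζc hs.1
        (by linarith [hs.2]) x).1,
      LogLaplace.contDiffOn_and_tendsto_iteratedDeriv_fracLaplace hN ha hH hu hR hc hζc hm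
        (by positivity) (by linarith) (by linarith) x⟩
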